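/- Let $h$ denote the absolute logarithmic Weil height on $\overline{\mathbb Q}$. For a number field $K\subset\overline{\mathbb Q}$ and $\beta\in\overline{\mathbb Q}$ put $m_K(\beta)=[K(\beta):K]\cdot h(\beta)$, and let $$m_{K,\infty}(\beta)=\inf\Bigl\{\max_{1\le n\le N} m_K(\beta_n)\;:\;N\ge 1,\ \beta_1,\dots,\beta_N\in\overline{\mathbb Q},\ \beta=\beta_1\beta_2\cdots\beta_N\Bigr\}.$$ Let $K$ be a number field with ring of integers $\mathcal O_K$. Suppose that the unit group $\mathcal O_K^\times$ has rank $1$, that $K$ has class number $1$, and that there exists a unit $\xi\in\mathcal O_K^\times$ such that $$0<[K:\mathbb Q]\cdot h(\xi)\le \log\min\bigl\{|\mathrm{Norm}_{K/\mathbb Q}(y)| : y\in\mathcal O_K,\ y\ne 0,\ y\notin\mathcal O_K^\times\bigr\}.$$ Then for every $\alpha\in K^\times\setminus\mathcal O_K^\times$ there exist $N\ge 1$ and $\alpha_1,\dots,\alpha_N\in K$ such that $\alpha=\alpha_1\alpha_2\cdots\alpha_N$ and $$m_{K,\infty}(\alpha)=\max\{m_K(\alpha_n):1\le n\le N\}.$$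 -/

import Mathlib

noncomputable section

namespace MetricMahler

open NumberField IntermediateField

/-- The Mahler measure of an algebraic number `x` over the number field `K`:
`m_K(x) = [K(x) : K] * h(x)`, where `h` is the absolute logarithmic Weil height. -/
def mahler (K : Type*) [Field K] [NumberField K] (x : AlgebraicClosure K) : ℝ :=
  (Module.finrank K K⟮x⟯ : ℝ) * absLogHeight₁ x

/-- The `∞`-metric Mahler measure over `K`: the infimum of `max_n m_K(a_n)` over all
factorizations `x = a_1 ⋯ a_N` with `N ≥ 1` and all `a_n` algebraic numbers.
(As `Fin N` is finite and nonempty, the supremum over `n` is a maximum.) -/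
def mahlerInfty (K : Type*) [Field K] [NumberField K] (x : AlgebraicClosure K) : ℝ :=
  sInf {M : ℝ | ∃ N : ℕ, 1 ≤ N ∧ ∃ a : Fin N → AlgebraicClosure K,
    x = ∏ n, a n ∧ M = ⨆ n, mahler K (a n)}

/-- The least absolute norm `|Norm_{K/ℚ}(y)|` of an element `y` of the ring of integers that is
neither zero nor a unit. The set of natural numbers is nonempty when `K` is a number field
(it contains the norm of `2`), so this infimum in `ℕ` is a minimum. -/
def minNonunitNorm (K : Type*) [Field K] [NumberField K] : ℕ :=
  sInf {m : ℕ | ∃ y : 𝓞 K, y ≠ 0 ∧ ¬ IsUnit y ∧ m = (Algebra.norm ℤ y).natAbs}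

end MetricMahler

end

/-! Write `d = [K : ℚ]` and `M = m_{K,∞}(α)`. The lower bound is local: if a prime `v` of `K` occurs
in `α`, then in any factorization over `K̄` some factor `b` is a non-unit at a place above `v`, and
this place alone forces `d * m_K(b) ≥ log N(v)` (`log_absNorm_le_mahlerInfty`). So `log |Norm p| ≤ d
* M` for every prime `p` of the numerator or denominator of `α`. For the upper bound, rank one means
that there are two archimedean places, and multiplying `p` by a suitable power of `ξ` brings `d * h`
down to at most `max (log |Norm p|) (d * h(ξ))` (`exists_zpow_mul_absLogHeight₁_le`). The condition
on `ξ`, together with some prime dividing `α`, makes this at most `d * M`. Class number one then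
writes `α` as a product of elements of `K` of height at most `M`, so the infimum is attained. -/

namespace MetricMahler

open NumberField IntermediateField IsDedekindDomain Height

/-! ### Finite places: heights and extensions of primes -/

section Places

variable {K L : Type*} [Field K] [Field L]

lemma exists_heightOneSpectrum_liesOver (L : Type*) [Field L] [NumberField L] [Algebra K L]
    (v : HeightOneSpectrum (𝓞 K)) :
    ∃ w : HeightOneSpectrum (𝓞 L), w.asIdeal.LiesOver v.asIdeal := by
  obtain ⟨P, hP, h⟩ := v.asIdeal.exists_ideal_over_prime_of_isIntegral_of_isDomain
    (S := 𝓞 L) (by simp)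
  have : P.LiesOver v.asIdeal := ⟨h.symm⟩
  exact ⟨⟨P, hP, Ideal.ne_bot_of_liesOver_of_ne_bot v.ne_bot P⟩, this⟩

variable [NumberField K]

lemma apply_le_mulHeight₁ (w : FinitePlace K) (x : K) : w x ≤ mulHeight₁ x := by
  classical
  rcases eq_or_ne x 0 with rfl | hx
  · simp
  rw [NumberField.mulHeight₁_eq]
  have hs : (fun v : FinitePlace K ↦ max (v x) 1).HasFiniteMulSupport := by
    have := FinitePlace.hasFiniteMulSupport hx
    fun_prop
  have h1 : 1 ≤ ∏ v : InfinitePlace K, max (v x) 1 ^ v.mult :=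
    Finset.prod_induction _ (fun r : ℝ ↦ 1 ≤ r) (fun _ _ ↦ one_le_mul_of_one_le_of_one_le) le_rfl
      fun v _ ↦ one_le_pow₀ (le_max_right ..)
  have h2 : w x ≤ ∏ᶠ v : FinitePlace K, max (v x) 1 := by
    rw [← mul_finprod_cond_ne (a := w) hs]
    refine (le_max_left (w x) 1).trans (le_mul_of_one_le_right (by positivity) ?_)
    exact one_le_finprod fun v ↦ one_le_finprod fun _ ↦ le_max_right ..
  exact h2.trans (le_mul_of_one_le_left (h2.trans' (apply_nonneg w x)) h1)

/-- The normalized absolute value at `v` takes only powers of `N(v)` as nonzero values, so there is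
a gap above 1. -/
lemma absNorm_le_finitePlace_apply {v : HeightOneSpectrum (𝓞 K)} {x : K}
    (hx : 1 < v.valuation K x) : (Ideal.absNorm v.asIdeal : ℝ) ≤ FinitePlace.mk v x := by
  rw [FinitePlace.mk_apply, FinitePlace.norm_embedding']
  have h0 : v.valuation K x ≠ 0 := (zero_lt_one.trans hx).ne'
  rw [WithZeroMulInt.toNNReal_neg_apply _ h0]
  have hN : (1 : ℝ) < Ideal.absNorm v.asIdeal := mod_cast HeightOneSpectrum.one_lt_absNorm v
  have h1 : 1 ≤ (WithZero.unzero h0).toAdd := by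
    have : (1 : WithZero (Multiplicative ℤ)) < (WithZero.unzero h0 : Multiplicative ℤ) := by
      rwa [WithZero.coe_unzero]
    have := WithZero.one_lt_coe.mp this
    exact this
  push_cast
  simpa using zpow_le_zpow_right₀ hN.le h1

lemma log_absNorm_le_logHeight₁ {v : HeightOneSpectrum (𝓞 K)} {x : K} (hx0 : x ≠ 0)
    (hx : v.valuation K x ≠ 1) : Real.log (Ideal.absNorm v.asIdeal) ≤ logHeight₁ x := by
  wlog h : 1 < v.valuation K x generalizing x
  · rw [← logHeight₁_inv]
    refine this (inv_ne_zero hx0) (by simpa using hx) ?_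
    rw [map_inv₀]
    exact (one_lt_inv₀ (by simpa [zero_lt_iff] using hx0)).mpr (lt_of_le_of_ne (not_lt.mp h) hx)
  refine Real.log_le_log (mod_cast (zero_lt_one.trans (HeightOneSpectrum.one_lt_absNorm v))) ?_
  exact (absNorm_le_finitePlace_apply h).trans (apply_le_mulHeight₁ ..)

variable [NumberField L] [Algebra K L]

lemma valuation_eq_one_iff_of_liesOver (v : HeightOneSpectrum (𝓞 K)) (w : HeightOneSpectrum (𝓞 L))
    [w.asIdeal.LiesOver v.asIdeal] (x : K) :
    w.valuation L (algebraMap K L x) = 1 ↔ v.valuation K x = 1 := by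
  rw [← HeightOneSpectrum.valuation_liesOver L v w]
  have he := Ideal.IsDedekindDomain.ramificationIdx'_ne_zero_of_liesOver w.asIdeal v.ne_bot
  refine ⟨fun h ↦ ?_, fun h ↦ by rw [h, one_pow]⟩
  rcases lt_trichotomy (v.valuation K x) 1 with hlt | heq | hgt
  · exact absurd h (pow_lt_one₀ zero_le hlt he).ne
  · exact heq
  · exact absurd h (one_lt_pow₀ hgt he).ne'

lemma absNorm_le_of_liesOver (v : HeightOneSpectrum (𝓞 K)) (w : HeightOneSpectrum (𝓞 L))
    [w.asIdeal.LiesOver v.asIdeal] :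
    Ideal.absNorm v.asIdeal ≤ Ideal.absNorm w.asIdeal := by
  rw [Ideal.absNorm_eq_pow_inertiaDeg'_of_liesOver w.asIdeal v.asIdeal v.isPrime v.ne_bot]
  have : v.asIdeal.IsMaximal := v.isMaximal
  exact Nat.le_self_pow (Ideal.inertiaDeg'_pos v.asIdeal w.asIdeal).ne' _

lemma absNorm_le_pow_of_liesOver (v : HeightOneSpectrum (𝓞 K)) (w : HeightOneSpectrum (𝓞 L))
    [w.asIdeal.LiesOver v.asIdeal] :
    Ideal.absNorm w.asIdeal ≤ Ideal.absNorm v.asIdeal ^ Module.finrank K L := by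
  rw [IsFractionRing.finrank_eq (𝓞 K) K (𝓞 L) L, ← Ideal.absNorm_algebraMap]
  refine Nat.le_of_dvd (Nat.pos_of_ne_zero ?_) (Ideal.absNorm_dvd_absNorm_of_le ?_)
  · rw [Ideal.absNorm_algebraMap]
    exact pow_ne_zero _ (zero_lt_one.trans (HeightOneSpectrum.one_lt_absNorm v)).ne'
  · exact Ideal.map_le_iff_le_comap.mpr (Ideal.over_def w.asIdeal v.asIdeal).le

end Places

/-! ### Absolute heights and sums over embeddings -/

lemma absLogHeight₁_eq {A : Type*} [Field A] [CharZero A] {x : A} (hx : IsIntegral ℚ x)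
    [NumberField ℚ⟮x⟯] :
    absLogHeight₁ x = logHeight₁ (AdjoinSimple.gen ℚ x) / Module.finrank ℚ ℚ⟮x⟯ := by
  rw [absLogHeight₁, absMulHeight₁, dif_pos hx, Real.log_rpow (mulHeight₁_pos _),
    logHeight₁_eq_log_mulHeight₁, div_eq_inv_mul]

lemma logHeight₁_div_finrank_congr {A : Type*} [Field A] [CharZero A] {E F : IntermediateField ℚ A}
    [NumberField E] [NumberField F] (h : E = F) {x : E} {y : F} (hxy : (x : A) = y) :
    logHeight₁ x / Module.finrank ℚ E = logHeight₁ y / Module.finrank ℚ F := by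
  subst h
  rw [Subtype.ext hxy]

lemma absLogHeight₁_inv {A : Type*} [Field A] [CharZero A] (x : A) :
    absLogHeight₁ x⁻¹ = absLogHeight₁ x := by
  by_cases hx : IsIntegral ℚ x
  · have hx' : IsIntegral ℚ x⁻¹ := hx.inv
    have h : ℚ⟮x⁻¹⟯ = ℚ⟮x⟯ := by
      refine le_antisymm ?_ ?_ <;> rw [adjoin_simple_le_iff]
      · exact inv_mem (mem_adjoin_simple_self ℚ x)
      · simpa using inv_mem (mem_adjoin_simple_self ℚ x⁻¹)
    have : FiniteDimensional ℚ ℚ⟮x⟯ := adjoin.finiteDimensional hx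
    have : NumberField ℚ⟮x⟯ := {}
    have : FiniteDimensional ℚ ℚ⟮x⁻¹⟯ := adjoin.finiteDimensional hx'
    have : NumberField ℚ⟮x⁻¹⟯ := {}
    rw [absLogHeight₁_eq hx, absLogHeight₁_eq hx', ← logHeight₁_inv (AdjoinSimple.gen ℚ x)]
    exact logHeight₁_div_finrank_congr h (by simp)
  · have hx' : ¬ IsIntegral ℚ x⁻¹ := fun h ↦ hx (by simpa using h.inv)
    rw [absLogHeight₁, absLogHeight₁, absMulHeight₁, absMulHeight₁, dif_neg hx, dif_neg hx']

lemma sum_embeddings_eq_sum_mult {K : Type*} [Field K] [NumberField K] (F : ℝ → ℝ) (x : K) :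
    ∑ φ : K →+* ℂ, F ‖φ x‖ = ∑ w : InfinitePlace K, w.mult * F (w x) := by
  classical
  rw [← Finset.univ.sum_fiberwise (fun φ : K →+* ℂ ↦ InfinitePlace.mk φ)]
  refine Finset.sum_congr rfl fun w _ ↦ ?_
  rw [← InfinitePlace.card_filter_mk_eq, ← nsmul_eq_mul, ← Finset.sum_const]
  refine Finset.sum_congr rfl fun φ hφ ↦ ?_
  rw [← (Finset.mem_filter.mp hφ).2, InfinitePlace.apply]

/-- Each embedding of `K` in `ℂ` has exactly `[L : K]` extensions to `L`. -/
lemma sum_embeddings_comp_algebraMap {K L : Type*} [Field K] [NumberField K] [Field L]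
    [NumberField L] [Algebra K L] (F : (K →+* ℂ) → ℝ) :
    ∑ φ : L →+* ℂ, F (φ.comp (algebraMap K L)) = Module.finrank K L * ∑ φ : K →+* ℂ, F φ := by
  classical
  rw [← Finset.univ.sum_fiberwise (fun φ : L →+* ℂ ↦ φ.comp (algebraMap K L)), Finset.mul_sum]
  refine Finset.sum_congr rfl fun ψ _ ↦ ?_
  rw [Finset.sum_congr rfl (g := fun _ ↦ F ψ) fun φ hφ ↦ by rw [(Finset.mem_filter.mp hφ).2],
    Finset.sum_const, nsmul_eq_mul]
  congr 2
  let _ : Algebra K ℂ := ψ.toAlgebra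
  rw [← AlgHom.card K L ℂ, ← Fintype.card_coe]
  refine Fintype.card_congr
    { toFun φ := { φ.1 with commutes' r := ?_ }
      invFun φ := ⟨φ.toRingHom, ?_⟩
      left_inv _ := rfl
      right_inv _ := rfl }
  · exact DFunLike.congr_fun (Finset.mem_filter.mp φ.2).2 r
  · exact Finset.mem_filter.mpr ⟨Finset.mem_univ _, φ.comp_algebraMap⟩

lemma logHeight₁_eq_sum_of_isIntegral {K : Type*} [Field K] [NumberField K] {x : K}
    (hx : IsIntegral ℤ x) :
    logHeight₁ x = ∑ w : InfinitePlace K, w.mult * Real.posLog (w x) := by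
  rw [NumberField.logHeight₁_eq, add_eq_left]
  refine finsum_eq_zero_of_forall_eq_zero fun v ↦ ?_
  rw [Real.posLog_eq_zero_iff, abs_of_nonneg (apply_nonneg v x), ← FinitePlace.norm_embedding_eq]
  exact FinitePlace.norm_le_one K v.maximalIdeal ⟨x, hx⟩

/-- The absolute height of an algebraic integer, computed in any number field containing it. -/
theorem finrank_mul_absLogHeight₁ {K A : Type*} [Field K] [NumberField K] [Field A] [CharZero A]
    (f : K →+* A) {x : K} (hx : IsIntegral ℤ x) :
    Module.finrank ℚ K * absLogHeight₁ (f x) =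
      ∑ w : InfinitePlace K, w.mult * Real.posLog (w x) := by
  have hfx : IsIntegral ℤ (f x) := hx.map f.toIntAlgHom
  have hfx' : IsIntegral ℚ (f x) := hfx.tower_top
  have : FiniteDimensional ℚ ℚ⟮f x⟯ := adjoin.finiteDimensional hfx'
  have : NumberField ℚ⟮f x⟯ := {}
  have hmin : minpoly ℚ (f x) = minpoly ℚ x := minpoly.algHom_eq f.toRatAlgHom f.injective x
  -- `K` is not a subfield of `A`, so `ℚ(f x)` is embedded in `K` by sending the generator to `x`,
  -- which has the same minimal polynomial.
  let g : ℚ⟮f x⟯ →ₐ[ℚ] K := (adjoin.powerBasis hfx').lift x (by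
    rw [adjoin.powerBasis_gen, minpoly_gen, hmin, minpoly.aeval])
  have hg : g (AdjoinSimple.gen ℚ (f x)) = x := (adjoin.powerBasis hfx').lift_gen ..
  let _ : Algebra ℚ⟮f x⟯ K := g.toRingHom.toAlgebra
  have hgen : IsIntegral ℤ (AdjoinSimple.gen ℚ (f x)) := by
    refine (isIntegral_algHom_iff (algebraMap ℚ⟮f x⟯ A).toIntAlgHom
      (algebraMap ℚ⟮f x⟯ A).injective).mp ?_
    simpa using hfx
  rw [absLogHeight₁_eq hfx', logHeight₁_eq_sum_of_isIntegral hgen, ← sum_embeddings_eq_sum_mult,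
    ← sum_embeddings_eq_sum_mult, ← Module.finrank_mul_finrank ℚ ℚ⟮f x⟯ K]
  have key := sum_embeddings_comp_algebraMap (L := K)
    fun φ : ℚ⟮f x⟯ →+* ℂ ↦ Real.posLog ‖φ (AdjoinSimple.gen ℚ (f x))‖
  have h (φ : K →+* ℂ) :
      (φ.comp (algebraMap ℚ⟮f x⟯ K)) (AdjoinSimple.gen ℚ (f x)) = φ x := congrArg φ hg
  simp only [h] at key
  rw [key]
  have : (Module.finrank ℚ ℚ⟮f x⟯ : ℝ) ≠ 0 := mod_cast Module.finrank_pos.ne'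
  push_cast
  field_simp

/-! ### Lower bound from a single prime -/

section LowerBound

variable {K : Type*} [Field K] [NumberField K]

lemma numberField_of_finiteDimensional {L : Type*} [Field L] [Algebra K L]
    [FiniteDimensional K L] : NumberField L where
  to_charZero := charZero_of_injective_algebraMap (algebraMap K L).injective
  to_finiteDimensional :=
    have : CharZero L := charZero_of_injective_algebraMap (algebraMap K L).injective
    Module.Finite.trans K L

/-- The height of `b` lives on `ℚ(b)`, so `w` is pushed down to a prime `r` there. Then `N(v) ≤ N(w)
≤ N(r) ^ [K(b) : ℚ(b)]`, and the tower identity `[K(b) : ℚ(b)] [ℚ(b) : ℚ] = [K : ℚ] [K(b) : K]`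
turns this exponent into the degree factor of `mahler`. -/
lemma log_absNorm_le_mahler {v : HeightOneSpectrum (𝓞 K)} {b : AlgebraicClosure K} (hb : b ≠ 0)
    [NumberField K⟮b⟯] (w : HeightOneSpectrum (𝓞 K⟮b⟯)) [w.asIdeal.LiesOver v.asIdeal]
    (hw : w.valuation K⟮b⟯ (AdjoinSimple.gen K b) ≠ 1) :
    Real.log (Ideal.absNorm v.asIdeal) ≤ Module.finrank ℚ K * mahler K b := by
  have hbK : IsIntegral K b := Algebra.IsIntegral.isIntegral b
  have hbQ : IsIntegral ℚ b := isIntegral_trans b hbK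
  have : FiniteDimensional ℚ ℚ⟮b⟯ := adjoin.finiteDimensional hbQ
  have : NumberField ℚ⟮b⟯ := {}
  have hle : ℚ⟮b⟯ ≤ K⟮b⟯.restrictScalars ℚ := by
    rw [adjoin_simple_le_iff]
    exact mem_adjoin_simple_self K b
  let _ : Algebra ℚ⟮b⟯ K⟮b⟯ := (IntermediateField.inclusion hle).toRingHom.toAlgebra
  have hgen : algebraMap ℚ⟮b⟯ K⟮b⟯ (AdjoinSimple.gen ℚ b) = AdjoinSimple.gen K b := rfl
  let r : HeightOneSpectrum (𝓞 ℚ⟮b⟯) := w.under (𝓞 ℚ⟮b⟯)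
  have : w.asIdeal.LiesOver r.asIdeal := ⟨rfl⟩
  have hr : r.valuation ℚ⟮b⟯ (AdjoinSimple.gen ℚ b) ≠ 1 := by
    rwa [Ne, ← valuation_eq_one_iff_of_liesOver r w, hgen]
  have h0 : AdjoinSimple.gen ℚ b ≠ 0 := fun h ↦ hb (congrArg Subtype.val h)
  have h1 := log_absNorm_le_logHeight₁ h0 hr
  have h2 : (Ideal.absNorm v.asIdeal : ℝ) ≤
      (Ideal.absNorm r.asIdeal : ℝ) ^ Module.finrank ℚ⟮b⟯ K⟮b⟯ := mod_cast
    (absNorm_le_of_liesOver v w).trans (absNorm_le_pow_of_liesOver r w)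
  have hd : (Module.finrank ℚ⟮b⟯ K⟮b⟯ : ℝ) * Module.finrank ℚ ℚ⟮b⟯ =
      Module.finrank ℚ K * Module.finrank K K⟮b⟯ := by
    rw [mul_comm]
    exact_mod_cast (Module.finrank_mul_finrank ℚ ℚ⟮b⟯ K⟮b⟯).trans
      (Module.finrank_mul_finrank ℚ K K⟮b⟯).symm
  have hpos : (0 : ℝ) < Module.finrank ℚ ℚ⟮b⟯ := mod_cast Module.finrank_pos
  calc Real.log (Ideal.absNorm v.asIdeal)
      ≤ Module.finrank ℚ⟮b⟯ K⟮b⟯ * Real.log (Ideal.absNorm r.asIdeal) := by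
        rw [← Real.log_pow]
        exact Real.log_le_log
          (mod_cast (zero_lt_one.trans (HeightOneSpectrum.one_lt_absNorm v))) h2
    _ ≤ Module.finrank ℚ⟮b⟯ K⟮b⟯ * logHeight₁ (AdjoinSimple.gen ℚ b) := by gcongr
    _ = Module.finrank ℚ K * mahler K b := by
        rw [mahler, absLogHeight₁_eq hbQ, ← mul_assoc, ← hd]
        field_simp

lemma mahler_nonneg (b : AlgebraicClosure K) : 0 ≤ mahler K b := by
  have hbQ : IsIntegral ℚ b := isIntegral_trans b (Algebra.IsIntegral.isIntegral (R := K) b)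
  have : FiniteDimensional ℚ ℚ⟮b⟯ := adjoin.finiteDimensional hbQ
  have : NumberField ℚ⟮b⟯ := {}
  rw [mahler, absLogHeight₁_eq hbQ]
  have := zero_le_logHeight₁ (AdjoinSimple.gen ℚ b)
  positivity

lemma exists_log_absNorm_le_mahler {v : HeightOneSpectrum (𝓞 K)} {x : K} (hx0 : x ≠ 0)
    (hx : v.valuation K x ≠ 1) {ι : Type*} [Fintype ι] (a : ι → AlgebraicClosure K)
    (ha : algebraMap K (AlgebraicClosure K) x = ∏ i, a i) :
    ∃ i, Real.log (Ideal.absNorm v.asIdeal) ≤ Module.finrank ℚ K * mahler K (a i) := by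
  let L : IntermediateField K (AlgebraicClosure K) := adjoin K (Set.range a)
  have : FiniteDimensional K L :=
    finiteDimensional_adjoin fun y _ ↦ Algebra.IsIntegral.isIntegral y
  have : NumberField L := numberField_of_finiteDimensional (K := K)
  obtain ⟨W, hW⟩ := exists_heightOneSpectrum_liesOver L v
  let b (i : ι) : L := ⟨a i, subset_adjoin K _ (Set.mem_range_self i)⟩
  have hprod : algebraMap K L x = ∏ i, b i := by
    apply Subtype.val_injective
    simpa [b] using ha
  have hWx : W.valuation L (algebraMap K L x) ≠ 1 := by
    rwa [Ne, valuation_eq_one_iff_of_liesOver v W]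
  -- Valuations are multiplicative: were every factor a unit at `W`, so would be `x`.
  obtain ⟨i, hi⟩ : ∃ i, W.valuation L (b i) ≠ 1 := by
    by_contra! h
    exact hWx (by rw [hprod, map_prod, Finset.prod_eq_one fun i _ ↦ h i])
  refine ⟨i, ?_⟩
  have hle : K⟮a i⟯ ≤ L := by
    rw [adjoin_simple_le_iff]
    exact (b i).2
  have : FiniteDimensional K K⟮a i⟯ := adjoin.finiteDimensional (Algebra.IsIntegral.isIntegral _)
  have : NumberField K⟮a i⟯ := numberField_of_finiteDimensional (K := K)
  let _ : Algebra K⟮a i⟯ L := (IntermediateField.inclusion hle).toRingHom.toAlgebra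
  have : IsScalarTower K K⟮a i⟯ L := .of_algebraMap_eq fun _ ↦ rfl
  let w : HeightOneSpectrum (𝓞 K⟮a i⟯) := W.under (𝓞 K⟮a i⟯)
  have : W.asIdeal.LiesOver w.asIdeal := ⟨rfl⟩
  have : IsScalarTower (𝓞 K) (𝓞 K⟮a i⟯) (𝓞 L) := .of_algebraMap_eq fun _ ↦ rfl
  have : w.asIdeal.LiesOver v.asIdeal := Ideal.LiesOver.tower_bot W.asIdeal w.asIdeal v.asIdeal
  refine log_absNorm_le_mahler ?_ w ?_
  · intro h
    refine hx0 ((algebraMap K (AlgebraicClosure K)).injective ?_)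
    rw [ha, map_zero, Finset.prod_eq_zero (Finset.mem_univ i) h]
  · rwa [Ne, ← valuation_eq_one_iff_of_liesOver w W]

theorem log_absNorm_le_mahlerInfty {v : HeightOneSpectrum (𝓞 K)} {x : K} (hx0 : x ≠ 0)
    (hx : v.valuation K x ≠ 1) :
    Real.log (Ideal.absNorm v.asIdeal) ≤
      Module.finrank ℚ K * mahlerInfty K (algebraMap K (AlgebraicClosure K) x) := by
  have hpos : (0 : ℝ) < Module.finrank ℚ K := mod_cast Module.finrank_pos
  rw [← div_le_iff₀' hpos]
  refine le_csInf ⟨_, 1, le_rfl, fun _ ↦ algebraMap K _ x, by simp, rfl⟩ ?_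
  rintro _ ⟨N, hN, a, ha, rfl⟩
  obtain ⟨i, hi⟩ := exists_log_absNorm_le_mahler hx0 hx a ha
  rw [div_le_iff₀' hpos]
  refine hi.trans ?_
  gcongr
  exact le_ciSup (f := fun n ↦ mahler K (a n)) (Set.finite_range _).bddAbove i

lemma mahlerInfty_le {x : AlgebraicClosure K} {N : ℕ} (hN : 1 ≤ N) (a : Fin N → AlgebraicClosure K)
    (ha : x = ∏ n, a n) : mahlerInfty K x ≤ ⨆ n, mahler K (a n) := by
  refine csInf_le ⟨0, ?_⟩ ⟨N, hN, a, ha, rfl⟩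
  rintro _ ⟨M, -, b, -, rfl⟩
  exact Real.iSup_nonneg fun n ↦ mahler_nonneg _

lemma mahler_algebraMap (x : K) :
    mahler K (algebraMap K (AlgebraicClosure K) x) =
      absLogHeight₁ (algebraMap K (AlgebraicClosure K) x) := by
  rw [mahler, finrank_adjoin_simple_eq_one_iff.mpr (IntermediateField.algebraMap_mem _ _)]
  simp

end LowerBound

/-! ### Upper bound: balancing with the unit -/

section UpperBound

variable {K : Type*} [Field K] [NumberField K]

lemma sum_mult_log_eq_log_norm {y : 𝓞 K} (hy : y ≠ 0) :
    ∑ w : InfinitePlace K, w.mult * Real.log (w y) =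
      Real.log (Algebra.norm ℤ y).natAbs := by
  have h : ((Algebra.norm ℤ y).natAbs : ℝ) = ∏ w : InfinitePlace K, w (y : K) ^ w.mult := by
    rw [InfinitePlace.prod_eq_abs_norm, ← Algebra.coe_norm_int, Nat.cast_natAbs]
    simp
  rw [h, Real.log_prod fun w _ ↦ pow_ne_zero _ (by simpa using hy)]
  simp [Real.log_pow]

lemma mult_mul_posLog {F : Type*} [Field F] (w : InfinitePlace F) (x : F) :
    w.mult * Real.posLog (w x) = max 0 (w.mult * Real.log (w x)) := by
  change w.mult * max 0 (Real.log (w x)) = _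
  rw [mul_max_of_nonneg _ _ (Nat.cast_nonneg _), mul_zero]

/-- If the unit rank is one, any nonzero algebraic integer of `K` can be multiplied by a power of a
given unit `ξ` of positive height so that its height becomes as small as its norm allows. -/
lemma exists_zpow_mul_absLogHeight₁_le {A : Type*} [Field A] [CharZero A] (f : K →+* A)
    (hrank : Units.rank K = 1) {ξ : (𝓞 K)ˣ}
    (hξ : 0 < Module.finrank ℚ K * absLogHeight₁ ((ξ : 𝓞 K) : K)) {y : 𝓞 K} (hy : y ≠ 0) :
    ∃ k : ℤ, Module.finrank ℚ K * absLogHeight₁ (f (y * ((ξ : 𝓞 K) : K) ^ k)) ≤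
      max (Real.log (Algebra.norm ℤ y).natAbs)
        (Module.finrank ℚ K * absLogHeight₁ ((ξ : 𝓞 K) : K)) := by
  classical
  have hcard : (Finset.univ : Finset (InfinitePlace K)).card = 2 := by
    rw [Units.rank] at hrank
    rw [Finset.card_univ]
    omega
  obtain ⟨w₁, w₂, hne, huniv⟩ := Finset.card_eq_two.mp hcard
  have hsum (F : InfinitePlace K → ℝ) : ∑ w, F w = F w₁ + F w₂ := by
    rw [huniv, Finset.sum_pair hne]
  have hξ0 : ((ξ : 𝓞 K) : K) ≠ 0 := by simp
  have hy0 : (y : K) ≠ 0 := by simpa using hy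
  have hξt := finrank_mul_absLogHeight₁ (RingHom.id K) (ξ : 𝓞 K).isIntegral_coe
  have hξN := sum_mult_log_eq_log_norm ξ.ne_zero
  have hyN := sum_mult_log_eq_log_norm hy
  rw [Int.isUnit_iff_natAbs_eq.mp (ξ.isUnit.map (Algebra.norm ℤ)), Nat.cast_one,
    Real.log_one, hsum] at hξN
  rw [hsum] at hyN
  simp only [RingHom.id_apply, mult_mul_posLog, hsum] at hξt
  set t := Module.finrank ℚ K * absLogHeight₁ ((ξ : 𝓞 K) : K)
  set P := Real.log (Algebra.norm ℤ y).natAbs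
  -- The weighted logarithms of `ξ` sum to 0 and their positive parts sum to `t`, so they are `(t,
  -- -t)` or `(-t, t)`. Powers of `ξ` thus shift the first coordinate of `y` by any multiple of `t`,
  -- and it can be put in `[0, t)`.
  have hk : ∃ k : ℤ, 0 ≤ w₁.mult * Real.log (w₁ y) + k * (w₁.mult * Real.log (w₁ (ξ : 𝓞 K))) ∧
      w₁.mult * Real.log (w₁ y) + k * (w₁.mult * Real.log (w₁ (ξ : 𝓞 K))) < t := by
    obtain ⟨m, ⟨hm0, hmt⟩, -⟩ := existsUnique_add_zsmul_mem_Ico hξ (w₁.mult * Real.log (w₁ y)) 0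
    rw [zsmul_eq_mul] at hm0 hmt
    rcases le_total 0 (w₁.mult * Real.log (w₁ (ξ : 𝓞 K))) with h | h
    · refine ⟨m, ?_⟩
      rw [show w₁.mult * Real.log (w₁ (ξ : 𝓞 K)) = t by
        rw [hξt, max_eq_right h, max_eq_left (by linarith), add_zero]]
      exact ⟨hm0, by linarith⟩
    · refine ⟨-m, ?_⟩
      rw [show w₁.mult * Real.log (w₁ (ξ : 𝓞 K)) = -t by
        rw [hξt, max_eq_left h, max_eq_right (by linarith)]; linarith]
      push_cast
      exact ⟨by linarith, by linarith⟩
  obtain ⟨k, hk0, hkt⟩ := hk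
  have hint : IsIntegral ℤ ((y : K) * ((ξ : 𝓞 K) : K) ^ k) := by
    have := (y * ((ξ ^ k : (𝓞 K)ˣ) : 𝓞 K)).isIntegral_coe
    simpa [Units.coe_zpow] using this
  have hlog (w : InfinitePlace K) : w.mult * Real.log (w (y * ((ξ : 𝓞 K) : K) ^ k)) =
      w.mult * Real.log (w y) + k * (w.mult * Real.log (w (ξ : 𝓞 K))) := by
    rw [map_mul, map_zpow₀, Real.log_mul (by simpa using hy) (zpow_ne_zero _ (by simp)),
      Real.log_zpow]
    ring
  refine ⟨k, ?_⟩
  rw [finrank_mul_absLogHeight₁ f hint]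
  simp only [mult_mul_posLog, hsum, hlog]
  have h2 : w₂.mult * Real.log (w₂ y) + k * (w₂.mult * Real.log (w₂ (ξ : 𝓞 K))) =
      P - (w₁.mult * Real.log (w₁ y) + k * (w₁.mult * Real.log (w₁ (ξ : 𝓞 K)))) := by
    linear_combination hyN + k * hξN
  rw [h2, max_eq_right hk0]
  -- The coordinates are now `c` in `[0, t)` and `P - c`; the sum of their positive parts is `P` if
  -- `c ≤ P`, and `c < t` otherwise.
  rcases le_total 0 (P - (w₁.mult * Real.log (w₁ y) + k * (w₁.mult * Real.log (w₁ (ξ : 𝓞 K)))))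
    with h | h
  · rw [max_eq_right h]
    exact le_max_of_le_left (by linarith)
  · rw [max_eq_left h]
    exact le_max_of_le_right (by linarith)

/-- The multiplicative monoid generated by the elements of `K` of height at most `M`. -/
def heightClosure (K : Type*) [Field K] [NumberField K] (M : ℝ) : Submonoid K :=
  Submonoid.closure {x : K | absLogHeight₁ (algebraMap K (AlgebraicClosure K) x) ≤ M}

lemma inv_mem_heightClosure {M : ℝ} {x : K} (hx : x ∈ heightClosure K M) :
    x⁻¹ ∈ heightClosure K M := by
  induction hx using Submonoid.closure_induction with
  | mem x hx => exact Submonoid.subset_closure (by simpa [absLogHeight₁_inv] using hx)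
  | one => simp
  | mul x y _ _ hx hy => rw [mul_inv]; exact mul_mem hx hy

/-- The balanced element `y * ξ ^ k` has height at most `M`; the power of `ξ` is then cancelled,
which is allowed because `ξ` and its inverse also have height at most `M`. -/
lemma mem_heightClosure_of_log_norm_le (hrank : Units.rank K = 1) {ξ : (𝓞 K)ˣ} {M : ℝ}
    (hξ : 0 < Module.finrank ℚ K * absLogHeight₁ ((ξ : 𝓞 K) : K))
    (hξM : Module.finrank ℚ K * absLogHeight₁ ((ξ : 𝓞 K) : K) ≤ Module.finrank ℚ K * M)
    {y : 𝓞 K} (hy : y ≠ 0)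
    (hyM : Real.log (Algebra.norm ℤ y).natAbs ≤ Module.finrank ℚ K * M) :
    (y : K) ∈ heightClosure K M := by
  have hpos : (0 : ℝ) < Module.finrank ℚ K := mod_cast Module.finrank_pos
  have hξ0 : ((ξ : 𝓞 K) : K) ≠ 0 := by simp
  have hξmem : ((ξ : 𝓞 K) : K) ∈ heightClosure K M := by
    refine Submonoid.subset_closure (le_of_mul_le_mul_left (le_trans (le_of_eq ?_) hξM) hpos)
    rw [finrank_mul_absLogHeight₁ _ (ξ : 𝓞 K).isIntegral_coe]
    exact (finrank_mul_absLogHeight₁ (RingHom.id K) (ξ : 𝓞 K).isIntegral_coe).symm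
  have hzpow (k : ℤ) : ((ξ : 𝓞 K) : K) ^ k ∈ heightClosure K M := by
    cases k with
    | ofNat n => simpa using pow_mem hξmem n
    | negSucc n => rw [zpow_negSucc]; exact inv_mem_heightClosure (pow_mem hξmem _)
  obtain ⟨k, hk⟩ := exists_zpow_mul_absLogHeight₁_le (algebraMap K (AlgebraicClosure K)) hrank hξ hy
  have h1 : (y : K) * ((ξ : 𝓞 K) : K) ^ k ∈ heightClosure K M :=
    Submonoid.subset_closure (le_of_mul_le_mul_left (hk.trans (max_le hyM hξM)) hpos)
  have h2 := mul_mem h1 (inv_mem_heightClosure (hzpow k))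
  rwa [mul_inv_cancel_right₀ (zpow_ne_zero _ hξ0)] at h2

/-- The place of `K` attached to a prime element of its ring of integers. -/
def primePlace {p : 𝓞 K} (hp : Prime p) : HeightOneSpectrum (𝓞 K) where
  asIdeal := Ideal.span {p}
  isPrime := (Ideal.span_singleton_prime hp.ne_zero).mpr hp
  ne_bot := by simpa using hp.ne_zero

lemma valuation_primePlace_eq_one_iff {p : 𝓞 K} (hp : Prime p) (y : 𝓞 K) :
    (primePlace hp).valuation K (y : K) = 1 ↔ ¬ p ∣ y := by
  rw [← Ideal.mem_span_singleton]
  exact (primePlace hp).valuation_eq_one_iff_notMem (K := K)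

/-- Coprimality rules out cancellation at `p` between numerator and denominator. -/
lemma valuation_primePlace_div_ne_one {p : 𝓞 K} (hp : Prime p) {a b : 𝓞 K}
    (hab : IsRelPrime a b) (h : p ∣ a ∨ p ∣ b) :
    (primePlace hp).valuation K ((a : K) / (b : K)) ≠ 1 := by
  rcases h with h | h
  · have hb : ¬ p ∣ b := fun hb ↦ hp.not_isUnit (hab h hb)
    rw [map_div₀, (valuation_primePlace_eq_one_iff hp b).mpr hb, div_one, Ne,
      valuation_primePlace_eq_one_iff]
    simpa using h
  · have ha : ¬ p ∣ a := fun ha ↦ hp.not_isUnit (hab ha h)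
    rw [map_div₀, (valuation_primePlace_eq_one_iff hp a).mpr ha, one_div, Ne, inv_eq_one,
      valuation_primePlace_eq_one_iff]
    simpa using h

lemma mem_heightClosure_of_forall_prime_dvd [UniqueFactorizationMonoid (𝓞 K)]
    (hrank : Units.rank K = 1) {ξ : (𝓞 K)ˣ} {M : ℝ}
    (hξ : 0 < Module.finrank ℚ K * absLogHeight₁ ((ξ : 𝓞 K) : K))
    (hξM : Module.finrank ℚ K * absLogHeight₁ ((ξ : 𝓞 K) : K) ≤ Module.finrank ℚ K * M)
    {y : 𝓞 K} (hy : y ≠ 0)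
    (hyM : ∀ p, Prime p → p ∣ y → Real.log (Algebra.norm ℤ p).natAbs ≤ Module.finrank ℚ K * M) :
    (y : K) ∈ heightClosure K M := by
  induction y using UniqueFactorizationMonoid.induction_on_prime with
  | h₁ => exact absurd rfl hy
  | h₂ u hu =>
    refine mem_heightClosure_of_log_norm_le hrank hξ hξM hy ?_
    rw [Int.isUnit_iff_natAbs_eq.mp (hu.map (Algebra.norm ℤ)), Nat.cast_one, Real.log_one]
    exact hξ.le.trans hξM
  | h₃ a p ha hp ih =>
    rw [show ((p * a : 𝓞 K) : K) = p * a from map_mul (algebraMap (𝓞 K) K) p a]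
    exact mul_mem
      (mem_heightClosure_of_log_norm_le hrank hξ hξM hp.ne_zero (hyM p hp (dvd_mul_right p a)))
      (ih ha fun q hq h ↦ hyM q hq (h.mul_left p))

lemma log_minNonunitNorm_le {y : 𝓞 K} (hy : y ≠ 0) (hy' : ¬ IsUnit y) :
    Real.log (minNonunitNorm K) ≤ Real.log (Algebra.norm ℤ y).natAbs := by
  have hle : minNonunitNorm K ≤ (Algebra.norm ℤ y).natAbs := Nat.sInf_le ⟨y, hy, hy', rfl⟩
  -- The value 0 needs no exclusion, since `Real.log 0 = 0`.
  rcases (minNonunitNorm K).eq_zero_or_pos with h | h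
  · rw [h, Nat.cast_zero, Real.log_zero]
    exact Real.log_natCast_nonneg _
  · exact Real.log_le_log (mod_cast h) (mod_cast hle)

lemma exists_fin_prod_of_mem_heightClosure {M : ℝ} (hM : 0 ≤ M) {x : K}
    (hx : x ∈ heightClosure K M) :
    ∃ N : ℕ, 1 ≤ N ∧ ∃ a : Fin N → K, x = ∏ n, a n ∧
      ∀ n, absLogHeight₁ (algebraMap K (AlgebraicClosure K) (a n)) ≤ M := by
  obtain ⟨l, hl, rfl⟩ := Submonoid.exists_list_of_mem_closure hx
  have h1 : absLogHeight₁ (algebraMap K (AlgebraicClosure K) 1) ≤ M := by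
    have h := finrank_mul_absLogHeight₁ (algebraMap K (AlgebraicClosure K)) (isIntegral_one (R := ℤ))
    simp only [map_one, Real.posLog_one, mul_zero, Finset.sum_const_zero, mul_eq_zero,
      Nat.cast_eq_zero, (Module.finrank_pos (R := ℚ) (M := K)).ne', false_or] at h
    rw [map_one, h]
    exact hM
  -- The list may be empty; an extra factor 1, of height 0, ensures `N ≥ 1`.
  refine ⟨(1 :: l).length, by simp, (1 :: l).get, ?_, fun n ↦ ?_⟩
  · simp [Fin.prod_univ_succ, ← List.prod_ofFn]
  · rcases List.mem_cons.mp ((1 :: l).get_mem n) with h | h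
    · rwa [h]
    · exact hl _ h

end UpperBound

end MetricMahler

open NumberField MetricMahler in
theorem corollary2p2 (K : Type*) [Field K] [NumberField K]
    (hrank : NumberField.Units.rank K = 1)
    (hclass : NumberField.classNumber K = 1)
    (hunit : ∃ ξ : (NumberField.RingOfIntegers K)ˣ,
      0 < (Module.finrank ℚ K : ℝ) *
          NumberField.absLogHeight₁ ((ξ : NumberField.RingOfIntegers K) : K) ∧
      (Module.finrank ℚ K : ℝ) *
          NumberField.absLogHeight₁ ((ξ : NumberField.RingOfIntegers K) : K) ≤
        Real.log (MetricMahler.minNonunitNorm K : ℝ))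
    (α : K) (hα : α ≠ 0)
    (hα' : ¬ ∃ u : (NumberField.RingOfIntegers K)ˣ,
      ((u : NumberField.RingOfIntegers K) : K) = α) :
    ∃ N : ℕ, 1 ≤ N ∧ ∃ a : Fin N → K, α = ∏ n, a n ∧
      MetricMahler.mahlerInfty K (algebraMap K (AlgebraicClosure K) α) =
        ⨆ n, MetricMahler.mahler K (algebraMap K (AlgebraicClosure K) (a n)) := by
  obtain ⟨ξ, hξ, hξmin⟩ := hunit
  have : IsPrincipalIdealRing (𝓞 K) := classNumber_eq_one_iff.mp hclass
  obtain ⟨a, b, hab, hmk⟩ := IsFractionRing.exists_reduced_fraction (𝓞 K) α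
  rw [IsFractionRing.mk'_eq_div] at hmk
  have hb : (b : 𝓞 K) ≠ 0 := nonZeroDivisors.coe_ne_zero b
  have ha : a ≠ 0 := by
    rintro rfl
    simp [← hmk] at hα
  set M := mahlerInfty K (algebraMap K (AlgebraicClosure K) α) with hMdef
  have hprime (p : 𝓞 K) (hp : Prime p) (h : p ∣ a ∨ p ∣ (b : 𝓞 K)) :
      Real.log (Algebra.norm ℤ p).natAbs ≤ Module.finrank ℚ K * M := by
    have hval := valuation_primePlace_div_ne_one hp hab h
    rw [← Ideal.absNorm_span_singleton]
    exact log_absNorm_le_mahlerInfty (v := primePlace hp) hα (hmk ▸ hval)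
  -- Otherwise numerator and denominator are both units, and so is `α`.
  obtain ⟨p, hp, hpab⟩ : ∃ p : 𝓞 K, Prime p ∧ (p ∣ a ∨ p ∣ (b : 𝓞 K)) := by
    by_contra! h
    have hu {y : 𝓞 K} (hy : y ≠ 0) (hdvd : ∀ p, Prime p → ¬ p ∣ y) : IsUnit y := by
      by_contra hyu
      obtain ⟨p, hp, hpy⟩ := WfDvdMonoid.exists_irreducible_factor hyu hy
      exact hdvd p hp.prime hpy
    obtain ⟨u, hu₁⟩ := hu ha fun p hp ↦ (h p hp).1
    obtain ⟨v, hv₁⟩ := hu hb fun p hp ↦ (h p hp).2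
    refine hα' ⟨u / v, ?_⟩
    rw [← hmk, ← hu₁, ← hv₁]
    rw [eq_div_iff (by simp), ← map_mul, ← Units.val_mul, div_mul_cancel]
  -- The size condition on `ξ` enters here, through the norm of one prime dividing `a` or `b`.
  have hξM := hξmin.trans ((log_minNonunitNorm_le hp.ne_zero hp.not_isUnit).trans (hprime p hp hpab))
  have hM : 0 ≤ M := (pos_of_mul_pos_right (hξ.trans_le hξM) (Nat.cast_nonneg _)).le
  have hmem : α ∈ heightClosure K M := by
    rw [← hmk, div_eq_mul_inv]
    exact mul_mem
      (mem_heightClosure_of_forall_prime_dvd hrank hξ hξM ha fun q hq h ↦ hprime q hq (.inl h))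
      (inv_mem_heightClosure <|
        mem_heightClosure_of_forall_prime_dvd hrank hξ hξM hb fun q hq h ↦ hprime q hq (.inr h))
  obtain ⟨N, hN, c, hc, hcM⟩ := exists_fin_prod_of_mem_heightClosure hM hmem
  refine ⟨N, hN, c, hc, le_antisymm (mahlerInfty_le hN _ (by rw [hc, map_prod])) ?_⟩
  have : Nonempty (Fin N) := ⟨⟨0, hN⟩⟩
  exact ciSup_le fun n ↦ (mahler_algebraMap (c n)).trans_le (hcM n)
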